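/- **Setting.** Fix weight parameters $0\le c_{\min}<1<c_{\max}$, $\lambda>0$, $\tau>0$, let $\sigma(t)=1/(1+e^{-t})$, $$c(h)=c_{\min}+\frac{c_{\max}-c_{\min}}{1+\frac{c_{\max}-1}{1-c_{\min}}\,e^{\lambda(h-\tau)}},\qquad w(h)=\begin{cases}\sigma(c(|h|)\,h)/\sigma(h), & h>-\tau,\\ 1, & h\le-\tau.\end{cases}$$ Let $r_\phi(x,y)$, $\phi\in\mathbb R^\delta$, be a reward model (measurable in $(x,y)$ for each $\phi$), with margin $h_\phi(x,y_w,y_l)=r_\phi(x,y_w)-r_\phi(x,y_l)$. Let $\pi_\theta(\cdot\mid x)$, $\theta\in\Theta$, and $\pi_{\mathrm{ref}}(\cdot\mid x)$ be discrete policies, let $\beta>0$, and let $$h_\theta(x,y_w,y_l)=\log\frac{\pi_\theta(y_w|x)}{\pi_{\mathrm{ref}}(y_w|x)}-\log\frac{\pi_\theta(y_l|x)}{\pi_{\mathrm{ref}}(y_l|x)}.$$ The MADPO loss of a sample is $$\mathcal L(\theta,\phi;x,y_w,y_l)=-\,w(h_\phi(x,y_w,y_l))\,\log\sigma(\beta h_\theta(x,y_w,y_l)).$$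 **Assumptions.** There are constants $B,\alpha_0,\alpha_1,\alpha_2,L_\theta>0$ such that: (1) the reward parameter space is $\Phi=\{\phi\in\mathbb R^\delta:\sum_i\phi_i=0,\ \|\phi\|\le B\}$; (2) for all $\phi\in\Phi$ and all $(x,y)$, $r_\phi(x,y)$ is twice differentiable in $\phi$, with $|r_\phi(x,y)|\le\alpha_0$, $\|\nabla_\phi r_\phi(x,y)\|\le\alpha_1$ and $-\alpha_2I\preceq\nabla^2_\phi r_\phi(x,y)\preceq\alpha_2 I$; (3) $|\log\sigma(\beta h_\theta(x,y_w,y_l))|\le L_\theta$ for all $\theta\in\Theta$ and all samples $(x,y_w,y_l)$. **Data.** Let $\phi^*\in\Phi$ and $N\ge1$. For $i=1,\dots,N$ a prompt with two responses $(x_i,y_i,y_i')$ is drawn, with an arbitrary joint law over $i$ (for instance i.i.d. or deterministic). Given all of these, the $N$ preferences are independent and follow the Bradley–Terry–Luce model: $y_i$ is preferred to $y_i'$ with probability $\sigma(r_{\phi^*}(x_i,y_i)-r_{\phi^*}(x_i,y_i'))$. Write $(x_i,y_{w,i},y_{l,i})$ for the labelled samples. A maximum likelihood estimate $\hat\phi$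 is any minimizer over $\Phi$ of $-\frac1N\sum_i\log\sigma(h_\phi(x_i,y_{w,i},y_{l,i}))$. Let $$\hat\Sigma_{\phi^*}=\frac1N\sum_{i=1}^N z_iz_i^\top,\qquad z_i=\nabla_\phi h_\phi(x_i,y_{w,i},y_{l,i})\big|_{\phi=\phi^*},\qquad \|v\|_M=\sqrt{v^\top Mv},\qquad \gamma=\frac1{2+e^{-4\alpha_0}+e^{4\alpha_0}}.$$ **Theorem.** There are absolute constants $C,C'>0$ and, for every $\kappa>0$, a constant $L>0$ depending only on $c_{\min},c_{\max},\lambda,\tau,L_\theta,\alpha_1,\kappa$, such that in the setting above the following holds. For every dataset, every $\theta\in\Theta$ and every sample, $\phi\mapsto\mathcal L(\theta,\phi;x,y_w,y_l)$ is $L$-Lipschitz on $\Phi$ with respect to $\|\cdot\|_{\hat\Sigma_{\phi^*}+\kappa I}$. Moreover, for every $\rho\in(0,1]$, with probability at least $1-\rho$, simultaneously for every maximum likelihood estimate $\hat\phi$, every $\theta\in\Theta$ and every sample $(x,y_w,y_l)$ (in particular every sample of the dataset), $$\big|\mathcal L(\theta,\phi^*;x,y_w,y_l)-\mathcal L(\theta,\hat\phi;x,y_w,y_l)\big|\le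 L\,\|\hat\phi-\phi^*\|_{\hat\Sigma_{\phi^*}+\kappa I}\le\frac{L\,C}{\gamma}\sqrt{\frac{\delta+\log(1/\rho)}{N}}+L\,C'B\sqrt{\kappa+\frac{\alpha_2}{\gamma}+\alpha_1\alpha_2B}.$$ -/

import Mathlib

noncomputable section

namespace MADPO

/-- Reward parameters: vectors of `ℝ^δ` with the Euclidean norm. -/
abbrev Param (δ : ℕ) := EuclideanSpace ℝ (Fin δ)

/-- A sample `(x, y_w, y_l)`: prompt, preferred response, rejected response. -/
abbrev Sample (X Y : Type*) := X × Y × Y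

/-- The margin-adaptive coefficient `c(h)`. -/
def coef (cmin cmax lam tau h : ℝ) : ℝ :=
  cmin + (cmax - cmin) / (1 + ((cmax - 1) / (1 - cmin)) * Real.exp (lam * (h - tau)))

/-- The piecewise weight `w(h)`. -/
def weight (cmin cmax lam tau h : ℝ) : ℝ :=
  if -tau < h then
    Real.sigmoid (coef cmin cmax lam tau |h| * h) / Real.sigmoid h
  else 1

/-- Explicit reward margin `r(x, y_w) - r(x, y_l)` of a reward function. -/
def margin {X Y : Type*} (r : X → Y → ℝ) (s : Sample X Y) : ℝ :=
  r s.1 s.2.1 - r s.1 s.2.2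

/-- Implicit reward margin of a policy relative to a reference policy. -/
def implicitMargin {X Y : Type*} (pol ref : X → PMF Y) (s : Sample X Y) : ℝ :=
  Real.log ((pol s.1 s.2.1).toReal / (ref s.1 s.2.1).toReal)
    - Real.log ((pol s.1 s.2.2).toReal / (ref s.1 s.2.2).toReal)

/-- The DPO log-likelihood term `log σ(β h_θ)` of one sample. -/
def dpoLogLik {X Y : Type*} (β : ℝ) (pol ref : X → PMF Y) (s : Sample X Y) : ℝ :=
  Real.log (Real.sigmoid (β * implicitMargin pol ref s))

/-- The MADPO loss of one sample, for a policy and a reward function. -/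
def loss {X Y : Type*} (cmin cmax lam tau β : ℝ) (pol ref : X → PMF Y) (r : X → Y → ℝ)
    (s : Sample X Y) : ℝ :=
  -(weight cmin cmax lam tau (margin r s)) * dpoLogLik β pol ref s

/-- The reward parameter space `Φ`: zero-sum vectors of norm at most `B`. -/
def paramSpace (δ : ℕ) (B : ℝ) : Set (Param δ) :=
  {φ | ∑ i, φ i = 0 ∧ ‖φ‖ ≤ B}

/-- At every `φ ∈ Φ` and every `(x, y)`, the reward is twice differentiable in `φ`, with
`|r| ≤ α₀`, `‖∇r‖ ≤ α₁` and `-α₂ I ⪯ ∇²r ⪯ α₂ I`. -/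
def RewardBounded {δ : ℕ} {X Y : Type*} (r : Param δ → X → Y → ℝ) (B α₀ α₁ α₂ : ℝ) : Prop :=
  ∀ φ ∈ paramSpace δ B, ∀ (x : X) (y : Y),
    DifferentiableAt ℝ (fun ψ => r ψ x y) φ ∧
    DifferentiableAt ℝ (gradient (fun ψ => r ψ x y)) φ ∧
    |r φ x y| ≤ α₀ ∧
    ‖gradient (fun ψ => r ψ x y) φ‖ ≤ α₁ ∧
    ∀ v : Param δ, |inner ℝ v (fderiv ℝ (gradient (fun ψ => r ψ x y)) φ v)| ≤ α₂ * ‖v‖ ^ 2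

/-- Order an unlabelled comparison `(x, y, y')` by the preference bit: `true` means that `y` is
preferred to `y'`. -/
def label {X Y : Type*} (s : X × Y × Y) (d : Bool) : Sample X Y :=
  if d then s else (s.1, s.2.2, s.2.1)

/-- The comparisons `S` are arbitrary random elements, and given all of them the preference bits
`d` are independent and follow the Bradley-Terry-Luce model with reward `r`: the outcome that
labels `(x, y, y')` as `(x, y_w, y_l)` has probability `σ(r(x, y_w) - r(x, y_l))`. -/
def IsBTLData {X Y Ω : Type*} [MeasurableSpace X] [MeasurableSpace Y] [MeasurableSpace Ω] {N : ℕ}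
    (P : MeasureTheory.Measure Ω) (S : Ω → Fin N → X × Y × Y) (d : Ω → Fin N → Bool)
    (r : X → Y → ℝ) : Prop :=
  Measurable S ∧ Measurable d ∧
    ∀ A : Set (Fin N → X × Y × Y), MeasurableSet A → ∀ b : Fin N → Bool,
      P {ω | S ω ∈ A ∧ d ω = b} =
        ∫⁻ ω in {ω | S ω ∈ A},
          ∏ i, ENNReal.ofReal (Real.sigmoid (margin r (label (S ω i) (b i)))) ∂P

/-- The preference dataset `(x_i, y_{w,i}, y_{l,i})`. -/
def dataset {X Y Ω : Type*} {N : ℕ} (S : Ω → Fin N → X × Y × Y) (d : Ω → Fin N → Bool)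
    (ω : Ω) : Fin N → Sample X Y :=
  fun i => label (S ω i) (d ω i)

/-- Negative log-likelihood of the reward model, averaged over a dataset. -/
def rmLoss {X Y : Type*} {N : ℕ} (D : Fin N → Sample X Y) (r : X → Y → ℝ) : ℝ :=
  -((1 / (N : ℝ)) * ∑ i, Real.log (Real.sigmoid (margin r (D i))))

/-- `φ` is a maximum likelihood estimate over `Φ`. -/
def IsMLE {δ : ℕ} {X Y : Type*} {N : ℕ} (r : Param δ → X → Y → ℝ) (B : ℝ)
    (D : Fin N → Sample X Y) (φ : Param δ) : Prop :=
  φ ∈ paramSpace δ B ∧ ∀ ψ ∈ paramSpace δ B, rmLoss D (r φ) ≤ rmLoss D (r ψ)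

/-- The empirical covariance `(1/N) ∑ z_i z_iᵀ` of the margin gradients `z_i = ∇_φ h_φ`. -/
def empCov {δ : ℕ} {X Y : Type*} {N : ℕ} (r : Param δ → X → Y → ℝ) (D : Fin N → Sample X Y)
    (φ : Param δ) : Matrix (Fin δ) (Fin δ) ℝ :=
  (1 / (N : ℝ)) • ∑ i,
    Matrix.vecMulVec (gradient (fun ψ => margin (r ψ) (D i)) φ).ofLp
      (gradient (fun ψ => margin (r ψ) (D i)) φ).ofLp

/-- The norm `‖v‖_M = √(vᵀ M v)`. -/
def matNorm {δ : ℕ} (M : Matrix (Fin δ) (Fin δ) ℝ) (v : Param δ) : ℝ :=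
  √(v.ofLp ⬝ᵥ (M.mulVec v.ofLp))

/-- `γ = 1 / (2 + e^{-4α₀} + e^{4α₀})`. -/
def gam (α₀ : ℝ) : ℝ := 1 / (2 + Real.exp (-4 * α₀) + Real.exp (4 * α₀))

end MADPO

end

namespace MADPO

/-! The reward parameter enters the loss only through the weight; the other factor is at most `Lθ`.
The weight is Lipschitz on the whole line because its two branches agree at `-τ`
(`exists_lipschitz_weight`), and the margin is `2α₁`-Lipschitz on the convex set `Φ`. The ridge `κI`
bounds the Euclidean norm by the matrix norm at the price `1/√κ`. This gives `L`.

The estimation error weighs curvature against noise. On `[-2α₀, 2α₀]` the function `-log σ` is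
strongly convex with modulus `γ`, and the margin is affine in `φ` up to a remainder of order `α₂`.
With `u = φ̂ - φ*` and `Q = ∑ ⟨z_i, u⟩²`, optimality of `φ̂` bounds `(γ/2) Q` by the score in
direction `u` plus remainders, which `‖u‖ ≤ 2B` controls. If the score is at most `K√Q`, this is a
quadratic inequality for `√Q`, and solving it gives both error terms (`IsMLE.matNorm_sub_le`).

Since `φ̂` depends on the data, the score bound must hold for all directions at once. Given the
comparisons, the score is a linear form in a centred Bernoulli vector, and the vectors `(⟨z_i,
u⟩)_i` fill a subspace of dimension at most `δ`. By Cauchy-Schwarz the score is at most `√Q` times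
the length `√Z` of the projection of the Bernoulli vector onto it. Sub-Gaussianity gives `E exp(Z/8)
≤ e^δ`, and Markov's inequality yields the event (`one_sub_le_sum_bern`). -/

/-! ### Lipschitz continuity of the weight -/

lemma abs_sub_le_of_Iic_of_Ici {f : ℝ → ℝ} {a K : ℝ}
    (hl : ∀ x ≤ a, ∀ y ≤ a, |f x - f y| ≤ K * |x - y|)
    (hr : ∀ x ≥ a, ∀ y ≥ a, |f x - f y| ≤ K * |x - y|) (x y : ℝ) :
    |f x - f y| ≤ K * |x - y| := by
  wlog hxy : x ≤ y generalizing x y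
  · rw [abs_sub_comm, abs_sub_comm x]
    exact this y x (le_of_not_ge hxy)
  rcases le_total y a with hy | hy
  · exact hl x (hxy.trans hy) y hy
  rcases le_total a x with hx | hx
  · exact hr x hx y hy
  -- The point `a` lies between `x` and `y`, so splitting there does not enlarge the constant.
  calc |f x - f y| ≤ |f x - f a| + |f a - f y| := abs_sub_le _ _ _
    _ ≤ K * |x - a| + K * |a - y| := add_le_add (hl x hx a le_rfl) (hr a le_rfl y hy)
    _ = K * |x - y| := by
      rw [abs_of_nonpos (by linarith : x - a ≤ 0), abs_of_nonpos (by linarith : a - y ≤ 0),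
        abs_of_nonpos (by linarith : x - y ≤ 0)]
      ring

/-- `u ↦ u / (1 + A e^{λu})` is Lipschitz on the nonnegative half-line. -/
lemma abs_div_logistic_sub_le {A lam : ℝ} (hA : 0 < A) (hlam : 0 < lam) {u v : ℝ}
    (hu : 0 ≤ u) (hv : 0 ≤ v) :
    |u / (1 + A * Real.exp (lam * u)) - v / (1 + A * Real.exp (lam * v))|
      ≤ (1 + 1 / A) * |u - v| := by
  have hder : ∀ t : ℝ, HasDerivAt (fun t => t / (1 + A * Real.exp (lam * t)))
      ((1 * (1 + A * Real.exp (lam * t)) - t * (A * (Real.exp (lam * t) * lam)))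
        / (1 + A * Real.exp (lam * t)) ^ 2) t := by
    intro t
    have h1 : HasDerivAt (fun t => Real.exp (lam * t)) (Real.exp (lam * t) * lam) t := by
      have := ((hasDerivAt_id t).const_mul lam).exp
      simpa using this
    exact (hasDerivAt_id t).div ((h1.const_mul A).const_add 1) (by positivity)
  have := (convex_Ici (0 : ℝ)).norm_image_sub_le_of_norm_hasDerivWithin_le
    (f := fun t => t / (1 + A * Real.exp (lam * t))) (C := 1 + 1 / A)
    (fun t _ => (hder t).hasDerivWithinAt) (fun t ht => ?_) hv hu
  · simpa [Real.norm_eq_abs] using this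
  · have ht : 0 ≤ t := ht
    rw [Real.norm_eq_abs, abs_div, abs_of_nonneg (a := (_ : ℝ) ^ 2) (by positivity),
      div_le_iff₀ (by positivity)]
    set E := Real.exp (lam * t) with hE
    have hE0 : 0 < E := Real.exp_pos _
    -- Absorbing `λt` into `e^{λt}` makes the numerator at most quadratic in `E`, like the
    -- denominator.
    have hle : lam * t ≤ E := by
      have := Real.add_one_le_exp (lam * t)
      linarith
    have hlt : 0 ≤ lam * t := by positivity
    have h1 : |1 * (1 + A * E) - t * (A * (E * lam))| ≤ (1 + A * E) + A * E * E := by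
      rw [abs_le]
      have : A * E * (lam * t) ≤ A * E * E := by gcongr
      have : 0 ≤ A * E * (lam * t) := by positivity
      have : 0 < A * E * E := by positivity
      have : 0 < A * E := by positivity
      constructor <;> nlinarith
    refine h1.trans ?_
    have : (1 + 1 / A) * (1 + A * E) ^ 2
        = (1 + A * E) + A * E * E + (A * E + A * E * (A * E) + 1 / A + 2 * E) := by
      field_simp
      ring
    rw [this]
    have : 0 < A * E + A * E * (A * E) + 1 / A + 2 * E := by positivity
    linarith

/-- The scaled margin `c(|h|) h` is Lipschitz. -/
lemma exists_lipschitz_coef_mul {cmin cmax lam tau : ℝ} (h1 : cmin < 1)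
    (h2 : 1 < cmax) (hlam : 0 < lam) :
    ∃ K, 0 ≤ K ∧ ∀ x y : ℝ,
      |coef cmin cmax lam tau |x| * x - coef cmin cmax lam tau |y| * y| ≤ K * |x - y| := by
  set A := (cmax - 1) / (1 - cmin) * Real.exp (-(lam * tau)) with hA
  have hA0 : 0 < A := mul_pos (div_pos (by linarith) (by linarith)) (Real.exp_pos _)
  have hc : ∀ u, coef cmin cmax lam tau u * u
      = cmin * u + (cmax - cmin) * (u / (1 + A * Real.exp (lam * u))) := by
    intro u
    have : (cmax - 1) / (1 - cmin) * Real.exp (lam * (u - tau)) = A * Real.exp (lam * u) := by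
      rw [hA, mul_assoc, ← Real.exp_add]
      ring_nf
    rw [coef, this]
    ring
  have hpos : ∀ x ≥ 0, ∀ y ≥ 0,
      |coef cmin cmax lam tau x * x - coef cmin cmax lam tau y * y|
        ≤ (|cmin| + (cmax - cmin) * (1 + 1 / A)) * |x - y| := by
    intro x hx y hy
    rw [hc, hc]
    calc _ = |cmin * (x - y) + (cmax - cmin) * (x / (1 + A * Real.exp (lam * x))
            - y / (1 + A * Real.exp (lam * y)))| := by ring_nf
      _ ≤ |cmin| * |x - y| + (cmax - cmin) * ((1 + 1 / A) * |x - y|) := by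
        refine (abs_add_le _ _).trans ?_
        rw [abs_mul, abs_mul, abs_of_nonneg (by linarith : 0 ≤ cmax - cmin)]
        have : 0 ≤ cmax - cmin := by linarith
        gcongr
        exact abs_div_logistic_sub_le hA0 hlam hx hy
      _ = _ := by ring
  refine ⟨|cmin| + (cmax - cmin) * (1 + 1 / A), ?_, ?_⟩
  · have : 0 ≤ cmax - cmin := by linarith
    positivity
  -- `x ↦ c(|x|) x` is odd, so the negative half-line reduces to the positive one.
  refine abs_sub_le_of_Iic_of_Ici (a := 0) ?_ ?_
  · intro x hx y hy
    have := hpos (-x) (by linarith) (-y) (by linarith)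
    rw [abs_of_nonpos hx, abs_of_nonpos hy]
    rw [show -x - -y = -(x - y) by ring, abs_neg] at this
    rw [← abs_neg]
    convert this using 2
    ring
  · intro x hx y hy
    rw [abs_of_nonneg hx, abs_of_nonneg hy]
    exact hpos x hx y hy

lemma abs_sigmoid_sub_le (x y : ℝ) : |Real.sigmoid x - Real.sigmoid y| ≤ |x - y| := by
  have := convex_univ.norm_image_sub_le_of_norm_hasDerivWithin_le
    (f := Real.sigmoid) (C := 1) (s := Set.univ)
    (fun t _ => (Real.hasDerivAt_sigmoid t).hasDerivWithinAt) (fun t _ => ?_)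
    (Set.mem_univ y) (Set.mem_univ x)
  · simpa using this
  · have h0 := Real.sigmoid_pos t
    have h1 := Real.sigmoid_lt_one t
    rw [Real.norm_eq_abs, abs_le]
    constructor <;> nlinarith

/-- This value glues the two branches of the weight: at `h = -τ` the first one reads `σ(-τ)/σ(-τ) =
1`. -/
lemma coef_tau {cmin cmax lam tau : ℝ} (h1 : cmin < 1) (h2 : 1 < cmax) :
    coef cmin cmax lam tau tau = 1 := by
  have h3 : 1 - cmin ≠ 0 := by linarith
  have h4 : 1 + (cmax - 1) / (1 - cmin) = (cmax - cmin) / (1 - cmin) := by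
    field_simp
    ring
  have h5 : cmax - cmin ≠ 0 := by linarith
  simp only [coef, sub_self, mul_zero, Real.exp_zero, mul_one, h4]
  field_simp
  ring

/-- The weight is Lipschitz on the real line: both branches agree at `-τ`. -/
lemma exists_lipschitz_weight {cmin cmax lam tau : ℝ} (h1 : cmin < 1)
    (h2 : 1 < cmax) (hlam : 0 < lam) (htau : 0 < tau) :
    ∃ K, 0 < K ∧ ∀ x y : ℝ,
      |weight cmin cmax lam tau x - weight cmin cmax lam tau y| ≤ K * |x - y| := by
  obtain ⟨K, hK, hKl⟩ := exists_lipschitz_coef_mul (tau := tau) h1 h2 hlam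
  have hM := Real.exp_pos tau
  refine ⟨K * (1 + Real.exp tau) + Real.exp tau, by positivity, ?_⟩
  have hw : ∀ x ≥ -tau, weight cmin cmax lam tau x
      = Real.sigmoid (coef cmin cmax lam tau |x| * x) * (1 + Real.exp (-x)) := by
    intro x hx
    rcases eq_or_lt_of_le hx with rfl | hx
    · rw [weight, if_neg (lt_irrefl _), abs_neg, abs_of_pos htau, coef_tau h1 h2, one_mul,
        Real.sigmoid_def, inv_mul_cancel₀ (by positivity)]
    · rw [weight, if_pos hx, div_eq_mul_inv, Real.sigmoid_def x, inv_inv]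
  refine abs_sub_le_of_Iic_of_Ici (a := -tau) ?_ ?_
  · intro x hx y hy
    rw [weight, weight, if_neg (not_lt.2 hx), if_neg (not_lt.2 hy), sub_self, abs_zero]
    positivity
  · intro x hx y hy
    rw [hw x hx, hw y hy]
    -- `1/σ(x) = 1 + e^{-x}` and its slope blow up only at `-∞`; the cutoff `-τ` bounds both.
    have hexp : |Real.exp (-x) - Real.exp (-y)| ≤ Real.exp tau * |x - y| := by
      have := (convex_Ici (-tau)).norm_image_sub_le_of_norm_hasDerivWithin_le
        (f := fun t => Real.exp (-t)) (C := Real.exp tau)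
        (fun t _ => (hasDerivAt_neg t).exp.hasDerivWithinAt) (fun t ht => ?_) hy hx
      · simpa using this
      · have ht : -tau ≤ t := ht
        simp only [mul_neg, mul_one, norm_neg, Real.norm_eq_abs, Real.abs_exp, Real.exp_le_exp]
        linarith
    set sx := Real.sigmoid (coef cmin cmax lam tau |x| * x)
    set sy := Real.sigmoid (coef cmin cmax lam tau |y| * y)
    have hs : |sx - sy| ≤ K * |x - y| := (abs_sigmoid_sub_le _ _).trans (hKl x y)
    have hsy : |sy| ≤ 1 := by
      rw [abs_of_pos (Real.sigmoid_pos _)]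
      exact Real.sigmoid_le_one _
    have hex : |1 + Real.exp (-x)| ≤ 1 + Real.exp tau := by
      rw [abs_of_pos (by positivity)]
      gcongr
      linarith
    calc _ = |(sx - sy) * (1 + Real.exp (-x)) + sy * (Real.exp (-x) - Real.exp (-y))| := by
          ring_nf
      _ ≤ |sx - sy| * |1 + Real.exp (-x)| + |sy| * |Real.exp (-x) - Real.exp (-y)| := by
          rw [← abs_mul, ← abs_mul]
          exact abs_add_le _ _
      _ ≤ (K * |x - y|) * (1 + Real.exp tau) + 1 * (Real.exp tau * |x - y|) := by gcongr
      _ = _ := by ring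

/-! ### Strong convexity of the logistic loss -/

/-- Second-order lower bound on the unit interval. -/
lemma add_deriv_add_half_le {g g' g'' : ℝ → ℝ} {m : ℝ}
    (hg : ∀ t ∈ Set.Icc (0 : ℝ) 1, HasDerivAt g (g' t) t)
    (hg' : ∀ t ∈ Set.Icc (0 : ℝ) 1, HasDerivAt g' (g'' t) t)
    (hm : ∀ t ∈ Set.Icc (0 : ℝ) 1, m ≤ g'' t) : g 0 + g' 0 + m / 2 ≤ g 1 := by
  have h0 : (0 : ℝ) ∈ Set.Icc (0 : ℝ) 1 := by simp
  have key : ∀ (f f' : ℝ → ℝ), (∀ t ∈ Set.Icc (0 : ℝ) 1, HasDerivAt f (f' t) t) →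
      (∀ t ∈ Set.Icc (0 : ℝ) 1, 0 ≤ f' t) → ∀ t ∈ Set.Icc (0 : ℝ) 1, f 0 ≤ f t := by
    intro f f' hf hf' t ht
    refine monotoneOn_of_deriv_nonneg (convex_Icc 0 1)
      (fun x hx => (hf x hx).continuousAt.continuousWithinAt)
      (fun x hx => (hf x (interior_subset hx)).differentiableAt.differentiableWithinAt)
      (fun x hx => ?_) h0 ht ht.1
    rw [(hf x (interior_subset hx)).deriv]
    exact hf' x (interior_subset hx)
  have h1 : ∀ t ∈ Set.Icc (0 : ℝ) 1, 0 ≤ g' t - (g' 0 + m * t) := by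
    intro t ht
    have := key (fun t => g' t - (g' 0 + m * t)) (fun t => g'' t - m * 1)
      (fun t ht => (hg' t ht).sub (((hasDerivAt_id t).const_mul m).const_add _))
      (fun t ht => by linarith [hm t ht]) t ht
    simpa using this
  have h2 := key (fun t => g t - (g' 0 * t + m / 2 * t ^ 2))
    (fun t => g' t - (g' 0 * 1 + m / 2 * (2 * t)))
    (fun t ht => (hg t ht).sub (((hasDerivAt_id t).const_mul (g' 0)).add
      (by simpa using (hasDerivAt_pow 2 t).const_mul (m / 2))))
    (fun t ht => by linarith [h1 t ht]) 1 (by simp)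
  simp only [mul_zero, zero_pow two_ne_zero, add_zero, sub_zero, mul_one, one_pow] at h2
  linarith

lemma gam_pos (a : ℝ) : 0 < gam a := by
  unfold gam
  positivity

/-- `σ(1 - σ) = 1/(2 + 2 cosh h)` decreases in `|h|`. The `4a` inside `gam` is not sharp here; `2a`
would do. -/
lemma gam_le_sigmoid_mul {a h : ℝ} (ha : |h| ≤ 2 * a) :
    gam a ≤ Real.sigmoid h * (1 - Real.sigmoid h) := by
  have ha0 : 0 ≤ a := by linarith [abs_nonneg h]
  have h1 : Real.sigmoid h * (1 - Real.sigmoid h) = 1 / (2 + Real.exp (-h) + Real.exp h) := by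
    rw [← Real.sigmoid_neg, Real.sigmoid_def, Real.sigmoid_def, neg_neg, ← mul_inv, one_div]
    congr 1
    have : Real.exp (-h) * Real.exp h = 1 := by rw [← Real.exp_add]; simp
    linear_combination this
  rw [h1, gam]
  have h2 : Real.cosh h ≤ Real.cosh (4 * a) := by
    rw [Real.cosh_le_cosh, abs_of_nonneg (by linarith : 0 ≤ 4 * a)]
    linarith
  rw [Real.cosh_eq, Real.cosh_eq] at h2
  apply one_div_le_one_div_of_le (by positivity)
  rw [neg_mul]
  linarith

/-- Strong convexity of `-log σ` on `[-2a, 2a]`. -/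
lemma neg_log_sigmoid_ge {a x y : ℝ} (hx : |x| ≤ 2 * a) (hy : |y| ≤ 2 * a) :
    -Real.log (Real.sigmoid x) - (1 - Real.sigmoid x) * (y - x) + gam a / 2 * (y - x) ^ 2
      ≤ -Real.log (Real.sigmoid y) := by
  have hl : ∀ t : ℝ, HasDerivAt (fun t : ℝ => x + t * (y - x)) (y - x) t := fun t => by
    simpa using ((hasDerivAt_id t).mul_const (y - x)).const_add x
  have hs : ∀ t : ℝ, HasDerivAt (fun t : ℝ => Real.sigmoid (x + t * (y - x)))
      (Real.sigmoid (x + t * (y - x)) * (1 - Real.sigmoid (x + t * (y - x))) * (y - x)) t :=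
    fun t => (Real.hasDerivAt_sigmoid _).comp t (hl t)
  have := add_deriv_add_half_le (g := fun t => -Real.log (Real.sigmoid (x + t * (y - x))))
    (g' := fun t => -((1 - Real.sigmoid (x + t * (y - x))) * (y - x)))
    (g'' := fun t => Real.sigmoid (x + t * (y - x)) * (1 - Real.sigmoid (x + t * (y - x)))
      * (y - x) ^ 2) (m := gam a * (y - x) ^ 2) ?_ ?_ ?_
  · simp only [zero_mul, add_zero, one_mul, add_sub_cancel] at this
    linarith
  · intro t _
    have := ((hs t).log (Real.sigmoid_pos _).ne').neg
    refine this.congr_deriv ?_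
    have := (Real.sigmoid_pos (x + t * (y - x))).ne'
    field_simp
  · intro t _
    refine (((hs t).const_sub 1).mul_const (y - x)).neg.congr_deriv ?_
    ring
  · intro t ht
    gcongr
    apply gam_le_sigmoid_mul
    rw [abs_le] at hx hy ⊢
    constructor <;> nlinarith [ht.1, ht.2]

/-! ### Self-normalized concentration for Bernoulli vectors -/

/-- Moment generating function bound for a centred Bernoulli variable. -/
lemma bernoulli_mgf_le {p : ℝ} (h0 : 0 ≤ p) (h1 : p ≤ 1) (c : ℝ) :
    p * Real.exp (c * (1 - p)) + (1 - p) * Real.exp (c * -p) ≤ Real.exp (c ^ 2 / 2) := by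
  have hq : 0 ≤ 1 - p := by linarith
  refine le_trans ?_ (Real.cosh_le_exp_half_sq c)
  -- Symmetrization: for `ε` centred Bernoulli, `E e^{-cε} ≥ 1`. Multiplying by it replaces `ε` by
  -- the difference of two independent copies, which takes values in `{-1, 0, 1}` and so has
  -- generating function at most `cosh c`.
  have hJ : 1 ≤ p * Real.exp (-(c * (1 - p))) + (1 - p) * Real.exp (-(c * -p)) := by
    have a1 := Real.add_one_le_exp (-(c * (1 - p)))
    have a2 := Real.add_one_le_exp (-(c * -p))
    nlinarith [mul_le_mul_of_nonneg_left a1 h0, mul_le_mul_of_nonneg_left a2 hq]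
  have e1 : Real.exp (c * (1 - p)) * Real.exp (-(c * (1 - p))) = 1 := by
    rw [← Real.exp_add]; simp
  have e2 : Real.exp (c * -p) * Real.exp (-(c * -p)) = 1 := by
    rw [← Real.exp_add]; simp
  have e3 : Real.exp (c * (1 - p)) * Real.exp (-(c * -p)) = Real.exp c := by
    rw [← Real.exp_add]; ring_nf
  have e4 : Real.exp (c * -p) * Real.exp (-(c * (1 - p))) = Real.exp (-c) := by
    rw [← Real.exp_add]; ring_nf
  have hnn : 0 ≤ p * Real.exp (c * (1 - p)) + (1 - p) * Real.exp (c * -p) := by positivity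
  have hc1 := Real.one_le_cosh c
  have hc : Real.exp c + Real.exp (-c) = 2 * Real.cosh c := by rw [Real.cosh_eq]; ring
  calc _ ≤ (p * Real.exp (c * (1 - p)) + (1 - p) * Real.exp (c * -p))
        * (p * Real.exp (-(c * (1 - p))) + (1 - p) * Real.exp (-(c * -p))) :=
        le_mul_of_one_le_right hnn hJ
    _ = p ^ 2 + (1 - p) ^ 2 + p * (1 - p) * (Real.exp c + Real.exp (-c)) := by
        linear_combination p ^ 2 * e1 + (1 - p) ^ 2 * e2 + p * (1 - p) * e3 + p * (1 - p) * e4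
    _ = Real.cosh c - (p ^ 2 + (1 - p) ^ 2) * (Real.cosh c - 1) := by rw [hc]; ring
    _ ≤ Real.cosh c := by
        have : 0 ≤ (p ^ 2 + (1 - p) ^ 2) * (Real.cosh c - 1) :=
          mul_nonneg (by positivity) (by linarith)
        linarith

/-- Gaussian linearization of a squared exponent. -/
lemma integral_exp_linear_sub_sq (z : ℝ) :
    MeasureTheory.Integrable (fun x : ℝ => Real.exp (z * x / 2 - x ^ 2 / 2)) ∧
      ∫ x : ℝ, Real.exp (z * x / 2 - x ^ 2 / 2) = Real.exp (z ^ 2 / 8) * √(2 * Real.pi) := by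
  have h : (fun x : ℝ => Real.exp (z * x / 2 - x ^ 2 / 2))
      = fun x => Real.exp (z ^ 2 / 8) * Real.exp (-(1 / 2) * (x - z / 2) ^ 2) := by
    funext x
    rw [← Real.exp_add]
    ring_nf
  rw [h]
  constructor
  · exact ((integrable_exp_neg_mul_sq (b := 1 / 2) (by norm_num)).comp_sub_right
      (z / 2)).const_mul _
  · rw [MeasureTheory.integral_const_mul,
      MeasureTheory.integral_sub_right_eq_self (fun x : ℝ => Real.exp (-(1 / 2) * x ^ 2)) (z / 2),
      integral_gaussian]
    congr 2
    ring

/-- Probability of the outcome `b` of a Bernoulli variable with parameter `p`. -/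
def bern (p : ℝ) (b : Bool) : ℝ := if b then p else 1 - p

/-- Value at `b` of the centred Bernoulli variable with parameter `p`. -/
def bernDev (p : ℝ) (b : Bool) : ℝ := if b then 1 - p else -p

lemma bern_nonneg {p : ℝ} (h0 : 0 ≤ p) (h1 : p ≤ 1) (b : Bool) : 0 ≤ bern p b := by
  cases b <;> simp [bern, h0, h1]

lemma sum_prod_bern {N : ℕ} (p : Fin N → ℝ) :
    ∑ b : Fin N → Bool, ∏ i, bern (p i) (b i) = 1 := by
  rw [← Fintype.prod_sum]
  simp [bern]

/-- Exponential moment of the squared length of a projection of a centred Bernoulli vector onto the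
span of `k` orthonormal vectors. -/
lemma sum_bern_exp_sq_le {N k : ℕ} (p : Fin N → ℝ) (h0 : ∀ i, 0 ≤ p i) (h1 : ∀ i, p i ≤ 1)
    (v : Fin k → Fin N → ℝ)
    (hv : ∀ g : Fin k → ℝ, ∑ i, (∑ j, g j * v j i) ^ 2 = ∑ j, g j ^ 2) :
    ∑ b : Fin N → Bool, (∏ i, bern (p i) (b i))
        * Real.exp ((∑ j, (∑ i, bernDev (p i) (b i) * v j i) ^ 2) / 8) ≤ Real.exp k := by
  set c : ℝ := (√(2 * Real.pi))⁻¹ with hc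
  have hs : 0 < √(2 * Real.pi) := by positivity
  have hc0 : 0 < c := inv_pos.2 hs
  let Z : (Fin N → Bool) → Fin k → ℝ := fun b j => ∑ i, bernDev (p i) (b i) * v j i
  -- Each `exp(Z_j²/8)` is a Gaussian average of exponentials linear in `Z_j`. Once linearized, the
  -- expectation over `b` factorizes over the coordinates `i`.
  let F : (Fin N → Bool) → (Fin k → ℝ) → ℝ := fun b x =>
    ∏ j, (c * Real.exp (Z b j * x j / 2 - x j ^ 2 / 2))
  have hFint : ∀ b, MeasureTheory.Integrable (F b) := fun b =>
    MeasureTheory.Integrable.fintype_prod_dep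
      (fun j => (integral_exp_linear_sub_sq (Z b j)).1.const_mul c)
  have hF : ∀ b, Real.exp ((∑ j, Z b j ^ 2) / 8) = ∫ x, F b x := by
    intro b
    rw [MeasureTheory.integral_fintype_prod_volume_eq_prod
      (fun j x => c * Real.exp (Z b j * x / 2 - x ^ 2 / 2)), Finset.sum_div, Real.exp_sum]
    refine Finset.prod_congr rfl fun j _ => ?_
    rw [MeasureTheory.integral_const_mul, (integral_exp_linear_sub_sq _).2, hc]
    field_simp
  have hG : MeasureTheory.Integrable
      (fun x : Fin k → ℝ => ∏ j, (c * Real.exp (-(3 / 8) * x j ^ 2))) :=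
    MeasureTheory.Integrable.fintype_prod_dep (E := fun _ => ℝ)
      (f := fun _ y => c * Real.exp (-(3 / 8) * y ^ 2))
      (fun _ => (integrable_exp_neg_mul_sq (by norm_num)).const_mul c)
  -- `bernoulli_mgf_le` at `y_i/2` costs `exp(y_i²/8)`, and orthonormality turns `∑ y_i²` into `∑
  -- x_j²`. The Gaussian exponent `1/2` drops to `1/2 - 1/8 = 3/8`.
  have hpt : ∀ x : Fin k → ℝ, ∑ b : Fin N → Bool, (∏ i, bern (p i) (b i)) * F b x
      ≤ ∏ j, (c * Real.exp (-(3 / 8) * x j ^ 2)) := by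
    intro x
    let y : Fin N → ℝ := fun i => ∑ j, x j * v j i
    have hFx : ∀ b, F b x = (∏ j, (c * Real.exp (-(x j ^ 2 / 2))))
        * ∏ i, Real.exp (y i / 2 * bernDev (p i) (b i)) := by
      intro b
      simp only [F, Finset.prod_mul_distrib, ← Real.exp_sum, mul_assoc]
      rw [← Real.exp_add]
      congr 2
      have : ∑ i, y i / 2 * bernDev (p i) (b i) = ∑ j, Z b j * x j / 2 := by
        simp only [y, Z, Finset.sum_div, Finset.sum_mul]
        rw [Finset.sum_comm]
        refine Finset.sum_congr rfl fun j _ => Finset.sum_congr rfl fun i _ => ?_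
        ring
      rw [this, ← Finset.sum_add_distrib]
      refine Finset.sum_congr rfl fun j _ => ?_
      ring
    have hsum : ∑ b : Fin N → Bool, ∏ i, (bern (p i) (b i)
        * Real.exp (y i / 2 * bernDev (p i) (b i))) ≤ Real.exp ((∑ j, x j ^ 2) / 8) := by
      rw [← Fintype.prod_sum (fun i b => bern (p i) b * Real.exp (y i / 2 * bernDev (p i) b)),
        ← hv x, Finset.sum_div, Real.exp_sum]
      refine Finset.prod_le_prod (fun i _ => Finset.sum_nonneg fun b _ =>
        mul_nonneg (bern_nonneg (h0 i) (h1 i) b) (Real.exp_pos _).le) fun i _ => ?_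
      have := bernoulli_mgf_le (h0 i) (h1 i) (y i / 2)
      rw [Fintype.sum_bool]
      simp only [bern, bernDev, if_true, Bool.false_eq_true, if_false]
      refine this.trans_eq ?_
      congr 1
      simp only [y]
      ring
    calc _ = (∏ j, (c * Real.exp (-(x j ^ 2 / 2)))) * ∑ b : Fin N → Bool, ∏ i, (bern (p i) (b i)
        * Real.exp (y i / 2 * bernDev (p i) (b i))) := by
          rw [Finset.mul_sum]
          refine Finset.sum_congr rfl fun b _ => ?_
          simp only [hFx, Finset.prod_mul_distrib]
          ring
      _ ≤ (∏ j, (c * Real.exp (-(x j ^ 2 / 2)))) * Real.exp ((∑ j, x j ^ 2) / 8) :=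
          mul_le_mul_of_nonneg_left hsum (Finset.prod_nonneg fun j _ => by positivity)
      _ = _ := by
          rw [Finset.sum_div, Real.exp_sum, ← Finset.prod_mul_distrib]
          refine Finset.prod_congr rfl fun j _ => ?_
          rw [mul_assoc, ← Real.exp_add]
          ring_nf
  calc _ = ∑ b : Fin N → Bool, ∫ x, (∏ i, bern (p i) (b i)) * F b x := by
        refine Finset.sum_congr rfl fun b _ => ?_
        rw [MeasureTheory.integral_const_mul, ← hF b]
    _ = ∫ x, ∑ b : Fin N → Bool, (∏ i, bern (p i) (b i)) * F b x :=
        (MeasureTheory.integral_finsetSum _ fun b _ => (hFint b).const_mul _).symm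
    _ ≤ ∫ x : Fin k → ℝ, ∏ j, (c * Real.exp (-(3 / 8) * x j ^ 2)) :=
        MeasureTheory.integral_mono
          (MeasureTheory.integrable_finsetSum _ fun b _ => (hFint b).const_mul _) hG hpt
    _ = (c * √(Real.pi / (3 / 8))) ^ k := by
        rw [MeasureTheory.integral_fintype_prod_volume_eq_prod
          (fun _ x => c * Real.exp (-(3 / 8) * x ^ 2)), MeasureTheory.integral_const_mul,
          integral_gaussian, Finset.prod_const, Finset.card_univ, Fintype.card_fin]
    -- The base equals `√(4/3)`; rounding it up to `e` lets the dimension add to `log(1/ρ)` in the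
    -- exponent.
    _ ≤ Real.exp 1 ^ k := by
        refine pow_le_pow_left₀ (by positivity) ?_ k
        have h2 : (2 : ℝ) ≤ Real.exp 1 := by
          have := Real.add_one_le_exp (1 : ℝ)
          linarith
        refine le_trans ?_ h2
        rw [hc, inv_mul_le_iff₀ hs, show √(2 * Real.pi) * 2 = √(2 * Real.pi) * √4 by
          rw [show (4 : ℝ) = 2 ^ 2 by norm_num, Real.sqrt_sq (by norm_num)],
          ← Real.sqrt_mul (by positivity)]
        apply Real.sqrt_le_sqrt
        have := Real.pi_pos
        linarith
    _ = Real.exp k := by rw [← Real.exp_nat_mul, mul_one]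

open Classical in
/-- Self-normalized concentration of a centred Bernoulli vector against a `δ`-dimensional family of
linear forms. -/
lemma one_sub_le_sum_bern {δ N : ℕ} (p : Fin N → ℝ) (h0 : ∀ i, 0 ≤ p i) (h1 : ∀ i, p i ≤ 1)
    (x : Fin N → Param δ) {ρ : ℝ} (hρ : 0 < ρ) (hρ1 : ρ ≤ 1) :
    1 - ρ ≤ ∑ b : Fin N → Bool,
      if ∀ u, ∑ i, bernDev (p i) (b i) * inner ℝ (x i) u
          ≤ √(8 * (δ + Real.log (1 / ρ))) * √(∑ i, inner ℝ (x i) u ^ 2)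
      then ∏ i, bern (p i) (b i) else 0 := by
  let T : Param δ →ₗ[ℝ] EuclideanSpace ℝ (Fin N) :=
    { toFun := fun u => WithLp.toLp 2 fun i => inner ℝ (x i) u
      map_add' := fun u w => by ext i; simp [inner_add_right]
      map_smul' := fun a u => by ext i; simp [inner_smul_right] }
  -- An orthonormal basis of the range replaces whitening by the Gram matrix, which may be singular.
  let k := Module.finrank ℝ (LinearMap.range T)
  have hk : k ≤ δ := by
    have := LinearMap.finrank_range_le T
    rwa [finrank_euclideanSpace_fin] at this
  let e := stdOrthonormalBasis ℝ (LinearMap.range T)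
  let v : Fin k → Fin N → ℝ := fun j i => (e j : EuclideanSpace ℝ (Fin N)) i
  have hnorm : ∀ g : Fin k → ℝ, ∑ i, (∑ j, g j * v j i) ^ 2 = ∑ j, g j ^ 2 := by
    intro g
    have hw := e.sum_sq_norm_inner_right (∑ j, g j • e j)
    have hcoe : ‖∑ j, g j • e j‖ ^ 2 = ∑ i, (∑ j, g j * v j i) ^ 2 := by
      rw [Submodule.coe_norm, EuclideanSpace.real_norm_sq_eq]
      refine Finset.sum_congr rfl fun i _ => ?_
      simp [v]
    rw [← hcoe, ← hw]
    refine Finset.sum_congr rfl fun j _ => ?_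
    rw [e.orthonormal.inner_right_fintype, Real.norm_eq_abs, sq_abs]
  -- Squared length of the projection onto the range. It does not involve `u`, so one event serves
  -- all directions.
  let Z : (Fin N → Bool) → ℝ := fun b => ∑ j, (∑ i, bernDev (p i) (b i) * v j i) ^ 2
  have hCS : ∀ b u, ∑ i, bernDev (p i) (b i) * inner ℝ (x i) u
      ≤ √(Z b) * √(∑ i, inner ℝ (x i) u ^ 2) := by
    intro b u
    let w : LinearMap.range T := ⟨T u, LinearMap.mem_range_self T u⟩
    let g : Fin k → ℝ := fun j => inner ℝ (e j) w
    have hTu : ∀ i, inner ℝ (x i) u = ∑ j, g j * v j i := by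
      intro i
      have h2 := congrArg (fun z : LinearMap.range T => (z : EuclideanSpace ℝ (Fin N)) i)
        (e.sum_repr' w)
      have h3 : (w : EuclideanSpace ℝ (Fin N)) i = inner ℝ (x i) u := rfl
      rw [← h3, ← h2]
      simp only [v, g, Submodule.coe_sum, Submodule.coe_smul, WithLp.ofLp_sum, WithLp.ofLp_smul,
        Finset.sum_apply, Pi.smul_apply, smul_eq_mul]
      rfl
    have hgs : ∑ i, inner ℝ (x i) u ^ 2 = ∑ j, g j ^ 2 := by
      rw [← hnorm g]
      exact Finset.sum_congr rfl fun i _ => by rw [hTu i]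
    rw [hgs]
    calc _ = ∑ j, (∑ i, bernDev (p i) (b i) * v j i) * g j := by
          simp only [hTu, Finset.mul_sum, Finset.sum_mul]
          rw [Finset.sum_comm]
          refine Finset.sum_congr rfl fun j _ => Finset.sum_congr rfl fun i _ => ?_
          ring
      _ ≤ _ := Real.sum_mul_le_sqrt_mul_sqrt _ _ _
  have hlog : 0 ≤ Real.log (1 / ρ) := Real.log_nonneg (by rw [le_div_iff₀ hρ]; linarith)
  have hmain := sum_bern_exp_sq_le p h0 h1 v hnorm
  have hw : ∀ b : Fin N → Bool, 0 ≤ ∏ i, bern (p i) (b i) := fun b =>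
    Finset.prod_nonneg fun i _ => bern_nonneg (h0 i) (h1 i) _
  -- Markov's inequality, outcome by outcome: where the bound fails, `Z ≥ 8(δ + log(1/ρ))`, hence `ρ
  -- e^{-δ} e^{Z/8} ≥ 1`.
  have hterm : ∀ b : Fin N → Bool, (∏ i, bern (p i) (b i))
      - ρ * Real.exp (-δ) * ((∏ i, bern (p i) (b i)) * Real.exp (Z b / 8))
      ≤ if ∀ u, ∑ i, bernDev (p i) (b i) * inner ℝ (x i) u
          ≤ √(8 * (δ + Real.log (1 / ρ))) * √(∑ i, inner ℝ (x i) u ^ 2)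
        then ∏ i, bern (p i) (b i) else 0 := by
    intro b
    split_ifs with hb
    · have : 0 ≤ ρ * Real.exp (-δ) * ((∏ i, bern (p i) (b i)) * Real.exp (Z b / 8)) :=
        mul_nonneg (by positivity) (mul_nonneg (hw b) (Real.exp_pos _).le)
      linarith
    · have hZ : 8 * (δ + Real.log (1 / ρ)) ≤ Z b := by
        by_contra! hlt
        refine hb fun u => (hCS b u).trans ?_
        gcongr
      have h3 : 1 ≤ ρ * Real.exp (-δ) * Real.exp (Z b / 8) := by
        have : Real.exp (δ + Real.log (1 / ρ)) ≤ Real.exp (Z b / 8) :=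
          Real.exp_le_exp.2 (by linarith)
        calc 1 = ρ * Real.exp (-δ) * Real.exp (δ + Real.log (1 / ρ)) := by
              rw [mul_assoc, ← Real.exp_add, neg_add_cancel_left, Real.exp_log (by positivity)]
              field_simp
          _ ≤ _ := by gcongr
      nlinarith [mul_le_mul_of_nonneg_left h3 (hw b)]
  refine le_trans ?_ (Finset.sum_le_sum fun b _ => hterm b)
  rw [Finset.sum_sub_distrib, sum_prod_bern, ← Finset.mul_sum]
  have h4 : ρ * Real.exp (-δ) * ∑ b : Fin N → Bool, (∏ i, bern (p i) (b i)) * Real.exp (Z b / 8)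
      ≤ ρ := by
    calc _ ≤ ρ * Real.exp (-δ) * Real.exp k := by gcongr
      _ ≤ ρ * Real.exp (-δ) * Real.exp δ := by gcongr
      _ = ρ := by rw [mul_assoc, ← Real.exp_add]; simp
  linarith

/-! ### Taylor bounds for rewards and margins -/

/-- The derivative bounds hold only at points of `Φ`; convexity keeps segments inside, where they
can be integrated. -/
lemma convex_paramSpace (δ : ℕ) (B : ℝ) : Convex ℝ (paramSpace δ B) := by
  intro φ hφ ψ hψ a b ha hb hab
  refine ⟨?_, ?_⟩
  · simp [Finset.sum_add_distrib, ← Finset.mul_sum, hφ.1, hψ.1]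
  · exact mem_closedBall_zero_iff.1 (convex_closedBall (0 : Param δ) B
      (mem_closedBall_zero_iff.2 hφ.2) (mem_closedBall_zero_iff.2 hψ.2) ha hb hab)

section Reward

variable {δ : ℕ} {X Y : Type*} {r : Param δ → X → Y → ℝ} {B α₀ α₁ α₂ : ℝ}

lemma RewardBounded.abs_sub_le (hr : RewardBounded r B α₀ α₁ α₂) {φ ψ : Param δ}
    (hφ : φ ∈ paramSpace δ B) (hψ : ψ ∈ paramSpace δ B) (x : X) (y : Y) :
    |r φ x y - r ψ x y| ≤ α₁ * ‖φ - ψ‖ := by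
  have := (convex_paramSpace δ B).norm_image_sub_le_of_norm_fderiv_le (𝕜 := ℝ)
    (f := fun ψ => r ψ x y) (C := α₁) (fun ξ hξ => (hr ξ hξ x y).1) (fun ξ hξ => ?_) hψ hφ
  · simpa [Real.norm_eq_abs] using this
  · have := (hr ξ hξ x y).2.2.2.1
    rwa [gradient, LinearIsometryEquiv.norm_map] at this

lemma RewardBounded.abs_margin_sub_le (hr : RewardBounded r B α₀ α₁ α₂) {φ ψ : Param δ}
    (hφ : φ ∈ paramSpace δ B) (hψ : ψ ∈ paramSpace δ B) (s : Sample X Y) :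
    |margin (r φ) s - margin (r ψ) s| ≤ 2 * α₁ * ‖φ - ψ‖ := by
  have h1 := abs_le.1 (hr.abs_sub_le hφ hψ s.1 s.2.1)
  have h2 := abs_le.1 (hr.abs_sub_le hφ hψ s.1 s.2.2)
  unfold margin
  rw [abs_le]
  constructor <;> linarith [h1.1, h1.2, h2.1, h2.2]

lemma RewardBounded.abs_margin_le (hr : RewardBounded r B α₀ α₁ α₂) {φ : Param δ}
    (hφ : φ ∈ paramSpace δ B) (s : Sample X Y) : |margin (r φ) s| ≤ 2 * α₀ := by
  have h1 := abs_le.1 (hr φ hφ s.1 s.2.1).2.2.1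
  have h2 := abs_le.1 (hr φ hφ s.1 s.2.2).2.2.1
  unfold margin
  rw [abs_le]
  constructor <;> linarith [h1.1, h1.2, h2.1, h2.2]

/-- Second-order Taylor bound for the reward along a segment of the parameter space. -/
lemma RewardBounded.abs_sub_sub_inner_le (hr : RewardBounded r B α₀ α₁ α₂) {φ ψ : Param δ}
    (hφ : φ ∈ paramSpace δ B) (hψ : ψ ∈ paramSpace δ B) (x : X) (y : Y) :
    |r ψ x y - r φ x y - inner ℝ (gradient (fun ξ => r ξ x y) φ) (ψ - φ)|
      ≤ α₂ / 2 * ‖ψ - φ‖ ^ 2 := by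
  set v := ψ - φ with hv
  set G := gradient (fun ξ => r ξ x y) with hG
  have hmem : ∀ t ∈ Set.Icc (0 : ℝ) 1, φ + t • v ∈ paramSpace δ B := fun t ht =>
    (convex_paramSpace δ B).add_smul_sub_mem hφ hψ ht
  have hl : ∀ t : ℝ, HasDerivAt (fun t : ℝ => φ + t • v) v t := fun t => by
    simpa using ((hasDerivAt_id t).smul_const v).const_add φ
  have hg : ∀ t ∈ Set.Icc (0 : ℝ) 1,
      HasDerivAt (fun t : ℝ => r (φ + t • v) x y) (inner ℝ (G (φ + t • v)) v) t := by
    intro t ht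
    have h1 := (hr _ (hmem t ht) x y).1
    have h2 := h1.hasFDerivAt.comp_hasDerivAt t (hl t)
    refine h2.congr_deriv ?_
    rw [hG, inner_gradient_left]
  have hg' : ∀ t ∈ Set.Icc (0 : ℝ) 1,
      HasDerivAt (fun t : ℝ => (inner ℝ (G (φ + t • v)) v : ℝ))
        (inner ℝ v (fderiv ℝ G (φ + t • v) v)) t := by
    intro t ht
    have h1 := (hr _ (hmem t ht) x y).2.1
    have h2 := (h1.hasFDerivAt.comp_hasDerivAt t (hl t)).inner ℝ (hasDerivAt_const t v)
    refine h2.congr_deriv ?_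
    rw [inner_zero_right, zero_add, real_inner_comm]
  have hb : ∀ t ∈ Set.Icc (0 : ℝ) 1,
      |inner ℝ v (fderiv ℝ G (φ + t • v) v)| ≤ α₂ * ‖v‖ ^ 2 :=
    fun t ht => (hr _ (hmem t ht) x y).2.2.2.2 v
  have lo := add_deriv_add_half_le hg hg' (m := -(α₂ * ‖v‖ ^ 2))
    (fun t ht => (abs_le.1 (hb t ht)).1)
  -- The upper Taylor bound is the lower one for the negated function.
  have hi := add_deriv_add_half_le (fun t ht => (hg t ht).neg) (fun t ht => (hg' t ht).neg)
    (m := -(α₂ * ‖v‖ ^ 2)) (fun t ht => neg_le_neg (abs_le.1 (hb t ht)).2)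
  simp only [Pi.neg_apply, zero_smul, add_zero, one_smul] at lo hi
  have hφv : φ + v = ψ := by rw [hv]; abel
  rw [hφv] at lo hi
  rw [abs_le]
  constructor <;> linarith

lemma RewardBounded.gradient_margin (hr : RewardBounded r B α₀ α₁ α₂) {φ : Param δ}
    (hφ : φ ∈ paramSpace δ B) (s : Sample X Y) :
    gradient (fun ψ => margin (r ψ) s) φ
      = gradient (fun ψ => r ψ s.1 s.2.1) φ - gradient (fun ψ => r ψ s.1 s.2.2) φ := by
  simp only [gradient, margin]
  rw [fderiv_fun_sub (hr φ hφ s.1 s.2.1).1 (hr φ hφ s.1 s.2.2).1, map_sub]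

lemma RewardBounded.abs_margin_sub_sub_inner_le (hr : RewardBounded r B α₀ α₁ α₂)
    {φ ψ : Param δ} (hφ : φ ∈ paramSpace δ B) (hψ : ψ ∈ paramSpace δ B) (s : Sample X Y) :
    |margin (r ψ) s - margin (r φ) s - inner ℝ (gradient (fun ξ => margin (r ξ) s) φ) (ψ - φ)|
      ≤ α₂ * ‖ψ - φ‖ ^ 2 := by
  rw [hr.gradient_margin hφ, inner_sub_left]
  have h1 := abs_le.1 (hr.abs_sub_sub_inner_le hφ hψ s.1 s.2.1)
  have h2 := abs_le.1 (hr.abs_sub_sub_inner_le hφ hψ s.1 s.2.2)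
  unfold margin
  rw [abs_le]
  constructor <;> linarith [h1.1, h1.2, h2.1, h2.2]

lemma RewardBounded.abs_inner_gradient_margin_le (hr : RewardBounded r B α₀ α₁ α₂)
    {φ : Param δ} (hφ : φ ∈ paramSpace δ B) (s : Sample X Y) (v : Param δ) :
    |inner ℝ (gradient (fun ξ => margin (r ξ) s) φ) v| ≤ 2 * α₁ * ‖v‖ := by
  refine (abs_real_inner_le_norm _ _).trans ?_
  gcongr
  rw [hr.gradient_margin hφ]
  have h1 := (hr φ hφ s.1 s.2.1).2.2.2.1
  have h2 := (hr φ hφ s.1 s.2.2).2.2.2.1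
  linarith [norm_sub_le (gradient (fun ψ => r ψ s.1 s.2.1) φ)
    (gradient (fun ψ => r ψ s.1 s.2.2) φ)]

lemma matNorm_empCov_add {N : ℕ} (D : Fin N → Sample X Y) (φ v : Param δ) (κ : ℝ) :
    matNorm (empCov r D φ + κ • (1 : Matrix (Fin δ) (Fin δ) ℝ)) v
      = √((1 / (N : ℝ)) * ∑ i, inner ℝ (gradient (fun ψ => margin (r ψ) (D i)) φ) v ^ 2
          + κ * ‖v‖ ^ 2) := by
  unfold matNorm empCov
  congr 1
  rw [Matrix.add_mulVec, dotProduct_add, Matrix.smul_mulVec, Matrix.smul_mulVec,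
    Matrix.one_mulVec, dotProduct_smul, dotProduct_smul, Matrix.sum_mulVec, dotProduct_sum,
    smul_eq_mul, smul_eq_mul]
  congr 2
  · refine Finset.sum_congr rfl fun i _ => ?_
    rw [EuclideanSpace.inner_eq_star_dotProduct, star_trivial, Matrix.vecMulVec_mulVec]
    simp only [dotProduct_smul, op_smul_eq_smul, smul_eq_mul]
    rw [dotProduct_comm (gradient (fun ψ => margin (r ψ) (D i)) φ).ofLp v.ofLp]
    ring
  · rw [EuclideanSpace.real_norm_sq_eq, dotProduct]
    exact Finset.sum_congr rfl fun i _ => by ring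

lemma sqrt_mul_norm_le_matNorm {N : ℕ} (D : Fin N → Sample X Y) (φ v : Param δ) {κ : ℝ}
    (hκ : 0 ≤ κ) :
    √κ * ‖v‖ ≤ matNorm (empCov r D φ + κ • (1 : Matrix (Fin δ) (Fin δ) ℝ)) v := by
  rw [matNorm_empCov_add]
  apply Real.le_sqrt_of_sq_le
  rw [mul_pow, Real.sq_sqrt hκ]
  have : 0 ≤ (1 / (N : ℝ)) * ∑ i, inner ℝ (gradient (fun ψ => margin (r ψ) (D i)) φ) v ^ 2 := by
    positivity
  linarith

/-- Quadratic lower bound on the log-likelihood loss of one sample. -/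
lemma RewardBounded.neg_log_sigmoid_margin_ge (hr : RewardBounded r B α₀ α₁ α₂)
    (hα₁ : 0 ≤ α₁) (hα₂ : 0 ≤ α₂) {φ ψ : Param δ}
    (hφ : φ ∈ paramSpace δ B) (hψ : ψ ∈ paramSpace δ B) (s : Sample X Y) :
    -Real.log (Real.sigmoid (margin (r φ) s))
      - (1 - Real.sigmoid (margin (r φ) s))
        * inner ℝ (gradient (fun ξ => margin (r ξ) s) φ) (ψ - φ)
      + gam α₀ / 2 * inner ℝ (gradient (fun ξ => margin (r ξ) s) φ) (ψ - φ) ^ 2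
      - (α₂ * ‖ψ - φ‖ ^ 2 + 2 * gam α₀ * α₁ * α₂ * ‖ψ - φ‖ ^ 3)
      ≤ -Real.log (Real.sigmoid (margin (r ψ) s)) := by
  refine le_trans ?_ (neg_log_sigmoid_ge (hr.abs_margin_le hφ s) (hr.abs_margin_le hψ s))
  have hq := hr.abs_inner_gradient_margin_le hφ s (ψ - φ)
  have hR := hr.abs_margin_sub_sub_inner_le hφ hψ s
  have hγ := gam_pos α₀
  set q : ℝ := inner ℝ (gradient (fun ξ => margin (r ξ) s) φ) (ψ - φ)
  set R := margin (r ψ) s - margin (r φ) s - q with hRdef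
  set d := ‖ψ - φ‖
  have hd : 0 ≤ d := norm_nonneg _
  -- With increment `q + R`, the remainder `R` costs `α₂d²` in the linear term and `2γα₁α₂d³` in the
  -- cross term of the square; the term in `R²` is dropped.
  have hnm : margin (r ψ) s - margin (r φ) s = q + R := by rw [hRdef]; ring
  rw [hnm]
  have hc0 : 0 ≤ 1 - Real.sigmoid (margin (r φ) s) := by
    linarith [Real.sigmoid_le_one (margin (r φ) s)]
  have hc1 : 1 - Real.sigmoid (margin (r φ) s) ≤ 1 := by
    linarith [Real.sigmoid_pos (margin (r φ) s)]
  have h1 : (1 - Real.sigmoid (margin (r φ) s)) * R ≤ α₂ * d ^ 2 := by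
    calc _ ≤ (1 - Real.sigmoid (margin (r φ) s)) * (α₂ * d ^ 2) := by
          gcongr
          exact (abs_le.1 hR).2
      _ ≤ 1 * (α₂ * d ^ 2) := by gcongr
      _ = _ := one_mul _
  have h2 : -(q * R) ≤ 2 * α₁ * d * (α₂ * d ^ 2) := by
    calc -(q * R) ≤ |q * R| := neg_le_abs _
      _ = |q| * |R| := abs_mul _ _
      _ ≤ _ := by gcongr
  have h3 : gam α₀ * -(q * R) ≤ gam α₀ * (2 * α₁ * d * (α₂ * d ^ 2)) := by gcongr
  have h4 : 0 ≤ gam α₀ / 2 * R ^ 2 := by positivity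
  nlinarith

/-! ### Estimation error of the maximum likelihood estimate -/

lemma le_add_sqrt_of_sq_le {a b e : ℝ} (hb : 0 ≤ b) (he : 0 ≤ e) (h : a ^ 2 ≤ b * a + e) :
    a ≤ b + √e := by
  by_contra! hlt
  have hs := Real.sqrt_nonneg e
  have hs2 := Real.sq_sqrt he
  nlinarith [mul_nonneg hb hs]

/-- Estimation error of a maximum likelihood estimate, given a bound on the score. -/
lemma IsMLE.matNorm_sub_le {N : ℕ} (hN : 0 < N) (hr : RewardBounded r B α₀ α₁ α₂)
    (hB : 0 < B) (hα₁ : 0 < α₁) (hα₂ : 0 < α₂) {κ K : ℝ} (hκ : 0 < κ) (hK : 0 ≤ K)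
    {D : Fin N → Sample X Y} {φ ψ : Param δ} (hφ : φ ∈ paramSpace δ B) (hψ : IsMLE r B D ψ)
    (hscore : ∑ i, (1 - Real.sigmoid (margin (r φ) (D i)))
          * inner ℝ (gradient (fun ξ => margin (r ξ) (D i)) φ) (ψ - φ)
        ≤ K * √(∑ i, inner ℝ (gradient (fun ξ => margin (r ξ) (D i)) φ) (ψ - φ) ^ 2)) :
    matNorm (empCov r D φ + κ • (1 : Matrix (Fin δ) (Fin δ) ℝ)) (ψ - φ)
      ≤ 2 / gam α₀ * (K / √N) + 8 * B * √(κ + α₂ / gam α₀ + α₁ * α₂ * B) := by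
  have hγ := gam_pos α₀
  have hn : (0 : ℝ) < N := Nat.cast_pos.2 hN
  rw [matNorm_empCov_add]
  have hd2B : ‖ψ - φ‖ ≤ 2 * B := by
    linarith [norm_sub_le ψ φ, hφ.2, hψ.1.2]
  have hd : 0 ≤ ‖ψ - φ‖ := norm_nonneg _
  have hsum := Finset.sum_le_sum fun i (_ : i ∈ Finset.univ) =>
    hr.neg_log_sigmoid_margin_ge hα₁.le hα₂.le hφ hψ.1 (D i)
  rw [Finset.sum_sub_distrib, Finset.sum_add_distrib, Finset.sum_sub_distrib,
    Finset.sum_neg_distrib, Finset.sum_neg_distrib, ← Finset.mul_sum, Finset.sum_const,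
    Finset.card_univ, Fintype.card_fin, nsmul_eq_mul] at hsum
  have hmle := hψ.2 φ hφ
  unfold rmLoss at hmle
  have hmle' : ∑ i, Real.log (Real.sigmoid (margin (r φ) (D i)))
      ≤ ∑ i, Real.log (Real.sigmoid (margin (r ψ) (D i))) :=
    le_of_mul_le_mul_left (neg_le_neg_iff.1 hmle) (by positivity : 0 < 1 / (N : ℝ))
  set Q := ∑ i, inner ℝ (gradient (fun ξ => margin (r ξ) (D i)) φ) (ψ - φ) ^ 2
  set d := ‖ψ - φ‖
  have hQ : 0 ≤ Q := Finset.sum_nonneg fun i _ => sq_nonneg _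
  have hmain : gam α₀ / 2 * Q
      ≤ K * √Q + N * (α₂ * d ^ 2 + 2 * gam α₀ * α₁ * α₂ * d ^ 3) := by linarith
  set a := √Q / √N with ha
  have hsN : 0 < √(N : ℝ) := Real.sqrt_pos.2 hn
  have ha2 : a ^ 2 = Q / N := by rw [ha, div_pow, Real.sq_sqrt hQ, Real.sq_sqrt hn.le]
  have ha0 : 0 ≤ a := by positivity
  -- Inserting `d ≤ 2B` gives the coefficients `8` and `32`; the larger is used for both.
  set e := 32 * B ^ 2 * (α₂ / gam α₀ + α₁ * α₂ * B) with he
  have he0 : 0 ≤ e := by positivity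
  have hquad : a ^ 2 ≤ 2 / gam α₀ * (K / √N) * a + e := by
    have h1 : Q ≤ 2 / gam α₀ * (K * √Q
        + N * (α₂ * d ^ 2 + 2 * gam α₀ * α₁ * α₂ * d ^ 3)) := by
      calc Q = 2 / gam α₀ * (gam α₀ / 2 * Q) := by field_simp
        _ ≤ _ := by gcongr
    have h2 : 2 / gam α₀ * (K / √N) * a = 2 / gam α₀ * (K * √Q) / N := by
      rw [ha, ← Real.sq_sqrt hn.le]
      simp only [Real.sqrt_sq hsN.le]
      field_simp
    have h3 : 2 / gam α₀ * (α₂ * d ^ 2 + 2 * gam α₀ * α₁ * α₂ * d ^ 3) ≤ e := by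
      calc _ ≤ 2 / gam α₀ * (α₂ * (2 * B) ^ 2 + 2 * gam α₀ * α₁ * α₂ * (2 * B) ^ 3) := by gcongr
        _ = 8 * B ^ 2 * (α₂ / gam α₀) + 32 * B ^ 2 * (α₁ * α₂ * B) := by
          field_simp
          ring
        _ ≤ e := by
          have : 0 ≤ B ^ 2 * (α₂ / gam α₀) := by positivity
          rw [he]
          linarith
    rw [ha2, h2]
    calc Q / N ≤ (2 / gam α₀ * (K * √Q
        + N * (α₂ * d ^ 2 + 2 * gam α₀ * α₁ * α₂ * d ^ 3))) / N := by gcongr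
      _ = 2 / gam α₀ * (K * √Q) / N
          + 2 / gam α₀ * (α₂ * d ^ 2 + 2 * gam α₀ * α₁ * α₂ * d ^ 3) := by
        field_simp
      _ ≤ _ := by linarith
  have hle := le_add_sqrt_of_sq_le (by positivity) he0 hquad
  set T := κ + α₂ / gam α₀ + α₁ * α₂ * B with hT
  have hT0 : 0 ≤ T := by positivity
  -- `32 ≤ 6²`. The `6` here and the `2` in `hsκ` add up to the `8` of the conclusion.
  have hse : √e ≤ 6 * B * √T := by
    apply Real.sqrt_le_iff.2 ⟨by positivity, ?_⟩
    rw [mul_pow, Real.sq_sqrt hT0, he, hT]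
    have : 0 ≤ α₂ / gam α₀ + α₁ * α₂ * B := by positivity
    nlinarith [sq_nonneg B, mul_nonneg (sq_nonneg B) this, mul_nonneg (sq_nonneg B) hκ.le]
  have hsκ : √κ * d ≤ 2 * B * √T := by
    rw [mul_comm (2 * B)]
    gcongr
    have : 0 ≤ α₂ / gam α₀ + α₁ * α₂ * B := by positivity
    linarith
  have hfin : √(1 / (N : ℝ) * Q + κ * d ^ 2) ≤ a + √κ * d := by
    apply Real.sqrt_le_iff.2 ⟨by positivity, ?_⟩
    have h1 : (√κ * d) ^ 2 = κ * d ^ 2 := by rw [mul_pow, Real.sq_sqrt hκ.le]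
    have h2 : 0 ≤ a * (√κ * d) := by positivity
    have h3 : 1 / (N : ℝ) * Q = a ^ 2 := by rw [ha2]; ring
    rw [h3]
    nlinarith
  linarith

end Reward

/-- The loss is Lipschitz in the reward margin. -/
lemma abs_loss_sub_le {X Y : Type*} {cmin cmax lam tau β K Lθ : ℝ} {pol ref : X → PMF Y}
    {r r' : X → Y → ℝ} {s : Sample X Y}
    (hK : ∀ x y : ℝ,
      |weight cmin cmax lam tau x - weight cmin cmax lam tau y| ≤ K * |x - y|)
    (hL : |dpoLogLik β pol ref s| ≤ Lθ) :
    |loss cmin cmax lam tau β pol ref r s - loss cmin cmax lam tau β pol ref r' s|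
      ≤ K * |margin r s - margin r' s| * Lθ := by
  have : loss cmin cmax lam tau β pol ref r s - loss cmin cmax lam tau β pol ref r' s
      = -((weight cmin cmax lam tau (margin r s) - weight cmin cmax lam tau (margin r' s))
        * dpoLogLik β pol ref s) := by
    unfold loss
    ring
  rw [this, abs_neg, abs_mul]
  have := hK (margin r s) (margin r' s)
  exact mul_le_mul this hL (abs_nonneg _) ((abs_nonneg _).trans this)

/-! ### The score under Bradley-Terry-Luce preferences -/

section Data

variable {δ : ℕ} {X Y : Type*} {r : Param δ → X → Y → ℝ} {B α₀ α₁ α₂ : ℝ}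

/-- The score of the labelled samples `D` at `φ` is bounded, in every direction, by `K` times its
self-normalization. -/
def ScoreBounded {N : ℕ} (r : Param δ → X → Y → ℝ) (φ : Param δ) (K : ℝ)
    (D : Fin N → Sample X Y) : Prop :=
  ∀ u, ∑ i, (1 - Real.sigmoid (margin (r φ) (D i)))
      * inner ℝ (gradient (fun ξ => margin (r ξ) (D i)) φ) u
    ≤ K * √(∑ i, inner ℝ (gradient (fun ξ => margin (r ξ) (D i)) φ) u ^ 2)

lemma sigmoid_margin_label (f : X → Y → ℝ) (s : X × Y × Y) (b : Bool) :
    Real.sigmoid (margin f (label s b)) = bern (Real.sigmoid (margin f s)) b := by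
  cases b
  · have : margin f (label s false) = -margin f s := by simp [margin, label]
    rw [this, Real.sigmoid_neg]
    simp [bern]
  · simp [bern, label]

lemma RewardBounded.inner_gradient_margin_label (hr : RewardBounded r B α₀ α₁ α₂)
    {φ : Param δ} (hφ : φ ∈ paramSpace δ B) (s : X × Y × Y) (b : Bool) (u : Param δ) :
    inner ℝ (gradient (fun ξ => margin (r ξ) (label s b)) φ) u
      = (if b then 1 else -1) * inner ℝ (gradient (fun ξ => margin (r ξ) s) φ) u := by
  rw [hr.gradient_margin hφ, hr.gradient_margin hφ]
  cases b <;> simp [label, inner_sub_left]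

/-- Swapping the two responses negates margin and gradient. The normalization is thus free of the
labels, and each score coefficient becomes a centred Bernoulli value. -/
lemma RewardBounded.scoreBounded_label_iff (hr : RewardBounded r B α₀ α₁ α₂)
    {φ : Param δ} (hφ : φ ∈ paramSpace δ B) {N : ℕ} (K : ℝ) (σ : Fin N → X × Y × Y)
    (b : Fin N → Bool) :
    ScoreBounded r φ K (fun i => label (σ i) (b i)) ↔
      ∀ u, ∑ i, bernDev (Real.sigmoid (margin (r φ) (σ i))) (b i)
          * inner ℝ (gradient (fun ξ => margin (r ξ) (σ i)) φ) u
        ≤ K * √(∑ i, inner ℝ (gradient (fun ξ => margin (r ξ) (σ i)) φ) u ^ 2) := by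
  refine forall_congr' fun u => ?_
  have h1 : ∀ i, (1 - Real.sigmoid (margin (r φ) (label (σ i) (b i))))
        * inner ℝ (gradient (fun ξ => margin (r ξ) (label (σ i) (b i))) φ) u
      = bernDev (Real.sigmoid (margin (r φ) (σ i))) (b i)
        * inner ℝ (gradient (fun ξ => margin (r ξ) (σ i)) φ) u := by
    intro i
    rw [sigmoid_margin_label, hr.inner_gradient_margin_label hφ]
    cases b i <;> simp [bern, bernDev]
  have h2 : ∀ i, inner ℝ (gradient (fun ξ => margin (r ξ) (label (σ i) (b i))) φ) u ^ 2
      = inner ℝ (gradient (fun ξ => margin (r ξ) (σ i)) φ) u ^ 2 := by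
    intro i
    rw [hr.inner_gradient_margin_label hφ]
    cases b i <;> simp
  simp only [h1, h2]

variable [MeasurableSpace X] [MeasurableSpace Y]

lemma measurable_margin (hm : ∀ φ, Measurable fun p : X × Y => r φ p.1 p.2) (φ : Param δ) :
    Measurable fun s : Sample X Y => margin (r φ) s := by
  have h1 : Measurable fun s : Sample X Y => r φ s.1 s.2.1 :=
    (hm φ).comp (measurable_fst.prodMk (measurable_fst.comp measurable_snd))
  have h2 : Measurable fun s : Sample X Y => r φ s.1 s.2.2 :=
    (hm φ).comp (measurable_fst.prodMk (measurable_snd.comp measurable_snd))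
  exact h1.sub h2

/-- A directional derivative is a limit of difference quotients. The points `φ + u/n` may leave `Φ`,
so measurability of `r` is used for all parameters. -/
lemma RewardBounded.measurable_inner_gradient_margin (hr : RewardBounded r B α₀ α₁ α₂)
    (hm : ∀ φ, Measurable fun p : X × Y => r φ p.1 p.2)
    {φ : Param δ} (hφ : φ ∈ paramSpace δ B) (u : Param δ) :
    Measurable fun s : Sample X Y => (inner ℝ (gradient (fun ξ => margin (r ξ) s) φ) u : ℝ) := by
  refine measurable_of_tendsto_metrizable
    (f := fun (n : ℕ) (s : Sample X Y) =>
      (n : ℝ) • (margin (r (φ + (n : ℝ)⁻¹ • u)) s - margin (r φ) s)) ?_ ?_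
  · intro n
    exact ((measurable_margin hm _).sub (measurable_margin hm _)).const_smul (n : ℝ)
  · rw [tendsto_pi_nhds]
    intro s
    have hd : DifferentiableAt ℝ (fun ξ => margin (r ξ) s) φ :=
      (hr φ hφ s.1 s.2.1).1.fun_sub (hr φ hφ s.1 s.2.2).1
    rw [inner_gradient_left]
    exact (hd.hasFDerivAt.lim_real u).comp tendsto_natCast_atTop_atTop

lemma measurable_label (b : Bool) : Measurable fun s : X × Y × Y => label s b := by
  cases b
  · simp only [label, Bool.false_eq_true, if_false]
    fun_prop
  · simp only [label, if_true]
    exact measurable_id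

/-- Both sides are continuous in `u`, so a countable dense set of directions suffices. -/
lemma RewardBounded.measurableSet_scoreBounded (hr : RewardBounded r B α₀ α₁ α₂)
    (hm : ∀ φ, Measurable fun p : X × Y => r φ p.1 p.2)
    {φ : Param δ} (hφ : φ ∈ paramSpace δ B) {N : ℕ} (K : ℝ) (b : Fin N → Bool) :
    MeasurableSet {σ : Fin N → X × Y × Y | ScoreBounded r φ K fun i => label (σ i) (b i)} := by
  have heq : {σ : Fin N → X × Y × Y | ScoreBounded r φ K fun i => label (σ i) (b i)}
      = ⋂ n : ℕ, {σ | ∑ i, (1 - Real.sigmoid (margin (r φ) (label (σ i) (b i))))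
          * inner ℝ (gradient (fun ξ => margin (r ξ) (label (σ i) (b i))) φ)
            (TopologicalSpace.denseSeq (Param δ) n)
        ≤ K * √(∑ i, inner ℝ (gradient (fun ξ => margin (r ξ) (label (σ i) (b i))) φ)
            (TopologicalSpace.denseSeq (Param δ) n) ^ 2)} := by
    ext σ
    simp only [Set.mem_iInter, Set.mem_ofPred_eq]
    refine ⟨fun h n => h _, fun h u => ?_⟩
    exact (TopologicalSpace.denseRange_denseSeq (Param δ)).induction_on u
      (isClosed_le (by fun_prop) (by fun_prop)) h
  rw [heq]
  refine MeasurableSet.iInter fun n => ?_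
  have hl : ∀ i, Measurable fun σ : Fin N → X × Y × Y => label (σ i) (b i) := fun i =>
    (measurable_label (b i)).comp (measurable_pi_apply i)
  have hi : ∀ i, Measurable fun σ : Fin N → X × Y × Y =>
      (inner ℝ (gradient (fun ξ => margin (r ξ) (label (σ i) (b i))) φ)
        (TopologicalSpace.denseSeq (Param δ) n) : ℝ) := fun i =>
    (hr.measurable_inner_gradient_margin hm hφ _).comp (hl i)
  have hs : ∀ i, Measurable fun σ : Fin N → X × Y × Y =>
      Real.sigmoid (margin (r φ) (label (σ i) (b i))) := fun i =>
    continuous_sigmoid.measurable.comp ((measurable_margin hm φ).comp (hl i))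
  refine measurableSet_le ?_ ?_
  · exact Finset.measurable_fun_sum _ fun i _ => ((hs i).const_sub 1).mul (hi i)
  · exact ((Finset.measurable_fun_sum _ fun i _ => (hi i).pow_const 2).sqrt).const_mul K

/-- Under Bradley-Terry-Luce preferences the score is self-normalized with probability at least
`1 - ρ`. -/
lemma IsBTLData.scoreBounded {Ω : Type*} [MeasurableSpace Ω] {P : MeasureTheory.Measure Ω}
    [MeasureTheory.IsProbabilityMeasure P] {N : ℕ} {S : Ω → Fin N → X × Y × Y}
    {d : Ω → Fin N → Bool} {φ : Param δ} (hdata : IsBTLData P S d (r φ))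
    (hr : RewardBounded r B α₀ α₁ α₂) (hm : ∀ φ, Measurable fun p : X × Y => r φ p.1 p.2)
    (hφ : φ ∈ paramSpace δ B) {ρ : ℝ} (hρ : 0 < ρ) (hρ1 : ρ ≤ 1) :
    MeasurableSet {ω | ScoreBounded r φ (√(8 * (δ + Real.log (1 / ρ)))) (dataset S d ω)} ∧
      ENNReal.ofReal (1 - ρ)
        ≤ P {ω | ScoreBounded r φ (√(8 * (δ + Real.log (1 / ρ)))) (dataset S d ω)} := by
  classical
  obtain ⟨hS, hd, hlaw⟩ := hdata
  set K := √(8 * (δ + Real.log (1 / ρ)))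
  let G : (Fin N → Bool) → Set (Fin N → X × Y × Y) := fun b =>
    {σ | ScoreBounded r φ K fun i => label (σ i) (b i)}
  have hG : ∀ b, MeasurableSet (G b) := fun b => hr.measurableSet_scoreBounded hm hφ K b
  let A : (Fin N → Bool) → Set Ω := fun b => {ω | S ω ∈ G b ∧ d ω = b}
  have hA : ∀ b, MeasurableSet (A b) := fun b =>
    (hS (hG b)).inter (hd (measurableSet_singleton b))
  have hU : {ω | ScoreBounded r φ K (dataset S d ω)} = ⋃ b, A b := by
    ext ω
    simp only [A, G, Set.mem_iUnion, Set.mem_ofPred_eq, exists_eq_right']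
    exact Iff.rfl
  have hdisj : Pairwise (Function.onFun Disjoint A) := by
    intro b b' hbb
    refine Set.disjoint_left.2 fun ω h h' => hbb ?_
    rw [← h.2, ← h'.2]
  rw [hU]
  refine ⟨MeasurableSet.iUnion hA, ?_⟩
  rw [MeasureTheory.measure_iUnion hdisj hA, tsum_fintype]
  -- The law of the data turns each probability into an integral over the comparisons alone; the sum
  -- over `b` inside is then bounded below for each fixed `ω`.
  have hterm : ∀ b, P (A b) = ∫⁻ ω, ENNReal.ofReal
      (if ScoreBounded r φ K (fun i => label (S ω i) (b i))
        then ∏ i, bern (Real.sigmoid (margin (r φ) (S ω i))) (b i) else 0) ∂P := by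
    intro b
    rw [hlaw (G b) (hG b) b,
      ← MeasureTheory.lintegral_indicator (show MeasurableSet {ω | S ω ∈ G b} from hS (hG b))]
    refine MeasureTheory.lintegral_congr fun ω => ?_
    by_cases h : ScoreBounded r φ K (fun i => label (S ω i) (b i))
    · rw [Set.indicator_of_mem (show ω ∈ {ω | S ω ∈ G b} from h), if_pos h,
        ← ENNReal.ofReal_prod_of_nonneg fun i _ => Real.sigmoid_nonneg _]
      simp only [sigmoid_margin_label]
    · rw [Set.indicator_of_notMem (show ω ∉ {ω | S ω ∈ G b} from h), if_neg h, ENNReal.ofReal_zero]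
  have hmeas : ∀ b : Fin N → Bool, Measurable fun ω => ENNReal.ofReal
      (if ScoreBounded r φ K (fun i => label (S ω i) (b i))
        then ∏ i, bern (Real.sigmoid (margin (r φ) (S ω i))) (b i) else 0) := by
    intro b
    refine (Measurable.ite (hS (hG b)) ?_ measurable_const).ennreal_ofReal
    simp only [← sigmoid_margin_label]
    exact Finset.measurable_fun_prod _ fun i _ => continuous_sigmoid.measurable.comp
      ((measurable_margin hm φ).comp ((measurable_label (b i)).comp
        ((measurable_pi_apply i).comp hS)))
  simp only [hterm]
  rw [← MeasureTheory.lintegral_finsetSum _ fun b _ => hmeas b]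
  calc ENNReal.ofReal (1 - ρ) = ∫⁻ _, ENNReal.ofReal (1 - ρ) ∂P := by simp
    _ ≤ _ := by
      refine MeasureTheory.lintegral_mono fun ω => ?_
      have hp0 : ∀ i, 0 ≤ Real.sigmoid (margin (r φ) (S ω i)) := fun i => Real.sigmoid_nonneg _
      have hp1 : ∀ i, Real.sigmoid (margin (r φ) (S ω i)) ≤ 1 := fun i => Real.sigmoid_le_one _
      rw [← ENNReal.ofReal_sum_of_nonneg]
      · refine ENNReal.ofReal_le_ofReal ((one_sub_le_sum_bern _ hp0 hp1
          (fun i => gradient (fun ξ => margin (r ξ) (S ω i)) φ) hρ hρ1).trans_eq ?_)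
        refine Finset.sum_congr rfl fun b _ => ?_
        simp only [hr.scoreBounded_label_iff hφ]
        rfl
      · intro b _
        split_ifs
        · exact Finset.prod_nonneg fun i _ => bern_nonneg (hp0 i) (hp1 i) _
        · exact le_rfl

end Data

end MADPO

/-! ### The main theorem -/

theorem theorem1 :
    -- `C`, `C'` are absolute constants.
    ∃ C > (0 : ℝ), ∃ C' > (0 : ℝ),
    -- The Lipschitz constant `L` depends only on the weight, `L_θ`, `α₁` and `κ`.
    ∀ (cmin cmax lam tau Lθ α₁ κ : ℝ), 0 ≤ cmin → cmin < 1 → 1 < cmax → 0 < lam → 0 < tau →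
      0 < Lθ → 0 < α₁ → 0 < κ →
    ∃ L > (0 : ℝ),
    ∀ (X Y Θ Ω : Type*) [MeasurableSpace X] [MeasurableSpace Y] [MeasurableSpace Ω]
      (P : MeasureTheory.Measure Ω) [MeasureTheory.IsProbabilityMeasure P]
      (δ N : ℕ) (B α₀ α₂ β ρ : ℝ)
      (r : MADPO.Param δ → X → Y → ℝ) (φstar : MADPO.Param δ)
      (pol : Θ → X → PMF Y) (ref : X → PMF Y)
      (S : Ω → Fin N → X × Y × Y) (d : Ω → Fin N → Bool),
      0 < N → 0 < B → 0 < α₀ → 0 < α₂ → 0 < β → 0 < ρ → ρ ≤ 1 →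
      (∀ φ, Measurable fun p : X × Y => r φ p.1 p.2) →
      MADPO.RewardBounded r B α₀ α₁ α₂ →
      (∀ (θ : Θ) (s : MADPO.Sample X Y), |MADPO.dpoLogLik β (pol θ) ref s| ≤ Lθ) →
      φstar ∈ MADPO.paramSpace δ B →
      MADPO.IsBTLData P S d (r φstar) →
      -- `L` is a Lipschitz constant of the loss in the reward parameter, for every dataset.
      (∀ (ω : Ω) (θ : Θ) (s : MADPO.Sample X Y),
        ∀ φ ∈ MADPO.paramSpace δ B, ∀ φ' ∈ MADPO.paramSpace δ B,
          |MADPO.loss cmin cmax lam tau β (pol θ) ref (r φ) s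
              - MADPO.loss cmin cmax lam tau β (pol θ) ref (r φ') s|
            ≤ L * MADPO.matNorm
                (MADPO.empCov r (MADPO.dataset S d ω) φstar
                  + κ • (1 : Matrix (Fin δ) (Fin δ) ℝ)) (φ - φ')) ∧
      -- With probability at least `1 - ρ`, both inequalities hold, uniformly.
      ∃ A : Set Ω, MeasurableSet A ∧ ENNReal.ofReal (1 - ρ) ≤ P A ∧
        ∀ ω ∈ A, ∀ φhat, MADPO.IsMLE r B (MADPO.dataset S d ω) φhat →
        ∀ (θ : Θ) (s : MADPO.Sample X Y),
          |MADPO.loss cmin cmax lam tau β (pol θ) ref (r φstar) s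
              - MADPO.loss cmin cmax lam tau β (pol θ) ref (r φhat) s|
            ≤ L * MADPO.matNorm
                (MADPO.empCov r (MADPO.dataset S d ω) φstar
                  + κ • (1 : Matrix (Fin δ) (Fin δ) ℝ)) (φhat - φstar) ∧
          L * MADPO.matNorm
                (MADPO.empCov r (MADPO.dataset S d ω) φstar
                  + κ • (1 : Matrix (Fin δ) (Fin δ) ℝ)) (φhat - φstar)
            ≤ L * C / MADPO.gam α₀ * √(((δ : ℝ) + Real.log (1 / ρ)) / (N : ℝ))
              + L * C' * B * √(κ + α₂ / MADPO.gam α₀ + α₁ * α₂ * B) := by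
  -- `6 = 2 · 3`: the `2` of `2/γ`, and `√8 ≤ 3`. The `8` comes from `IsMLE.matNorm_sub_le`.
  refine ⟨6, by norm_num, 8, by norm_num, ?_⟩
  intro cmin cmax lam tau Lθ α₁ κ _ hcmin hcmax hlam htau hLθ hα₁ hκ
  obtain ⟨W, hW, hWl⟩ := MADPO.exists_lipschitz_weight hcmin hcmax hlam htau
  have hsκ : 0 < √κ := Real.sqrt_pos.2 hκ
  refine ⟨W * (2 * α₁) * Lθ / √κ, by positivity, ?_⟩
  intro X Y Θ Ω _ _ _ P _ δ N B α₀ α₂ β ρ r φstar pol ref S d hN hB _ hα₂ _ hρ hρ1 hm hr hlik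
    hφ hdata
  have hL : 0 < W * (2 * α₁) * Lθ / √κ := by positivity
  have hlip : ∀ (ω : Ω) (θ : Θ) (s : MADPO.Sample X Y),
      ∀ φ ∈ MADPO.paramSpace δ B, ∀ φ' ∈ MADPO.paramSpace δ B,
        |MADPO.loss cmin cmax lam tau β (pol θ) ref (r φ) s
            - MADPO.loss cmin cmax lam tau β (pol θ) ref (r φ') s|
          ≤ W * (2 * α₁) * Lθ / √κ * MADPO.matNorm
              (MADPO.empCov r (MADPO.dataset S d ω) φstar
                + κ • (1 : Matrix (Fin δ) (Fin δ) ℝ)) (φ - φ') := by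
    intro ω θ s φ h1 φ' h2
    calc _ ≤ W * |MADPO.margin (r φ) s - MADPO.margin (r φ') s| * Lθ :=
          MADPO.abs_loss_sub_le hWl (hlik θ s)
      _ ≤ W * (2 * α₁ * ‖φ - φ'‖) * Lθ := by
          gcongr
          exact hr.abs_margin_sub_le h1 h2 s
      _ = W * (2 * α₁) * Lθ / √κ * (√κ * ‖φ - φ'‖) := by field_simp
      _ ≤ _ := by
          gcongr
          exact MADPO.sqrt_mul_norm_le_matNorm _ _ _ hκ.le
  refine ⟨hlip, _, (hdata.scoreBounded hr hm hφ hρ hρ1).1,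
    (hdata.scoreBounded hr hm hφ hρ hρ1).2, ?_⟩
  intro ω hω φhat hmle θ s
  constructor
  · rw [abs_sub_comm]
    exact hlip ω θ s φhat hmle.1 φstar hφ
  · have hlog : 0 ≤ Real.log (1 / ρ) := Real.log_nonneg (by rw [le_div_iff₀ hρ]; linarith)
    have hγ := MADPO.gam_pos α₀
    -- The direction `φ̂ - φ*` is random; the event `hω` covers every direction.
    have hest := hmle.matNorm_sub_le hN hr hB hα₁ hα₂ hκ (Real.sqrt_nonneg _) hφ
      (hω (φhat - φstar))
    have hK : √(8 * ((δ : ℝ) + Real.log (1 / ρ))) / √(N : ℝ)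
        ≤ 3 * √(((δ : ℝ) + Real.log (1 / ρ)) / (N : ℝ)) := by
      rw [Real.sqrt_div (by positivity), ← mul_div_assoc]
      gcongr
      rw [Real.sqrt_mul (by norm_num)]
      gcongr
      rw [Real.sqrt_le_left (by norm_num)]
      norm_num
    set T := √(((δ : ℝ) + Real.log (1 / ρ)) / (N : ℝ))
    set U := √(κ + α₂ / MADPO.gam α₀ + α₁ * α₂ * B)
    set L := W * (2 * α₁) * Lθ / √κ
    calc _ ≤ L * (2 / MADPO.gam α₀ * (√(8 * ((δ : ℝ) + Real.log (1 / ρ))) / √(N : ℝ))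
          + 8 * B * U) := by gcongr
      _ ≤ L * (2 / MADPO.gam α₀ * (3 * T) + 8 * B * U) := by gcongr
      _ = _ := by ring
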